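/- Let $\mathbb{D}=\{z\in\mathbb{C}:|z|<1\}$. Let $S_H^O$ be the class of complex-valued harmonic, sense-preserving, univalent functions $f$ on $\mathbb{D}$ with $f(0)=0$, $f_z(0)=1$ and $f_{\bar z}(0)=0$, where sense-preserving means $|f_{\bar z}|<|f_z|$ on $\mathbb{D}$, and let $K_H^O$ be the subclass of those $f\in S_H^O$ for which $f(\mathbb{D})$ is convex. Every $f\in S_H^O$ is written as $f=h+\overline{g}$ with $h,g$ analytic in $\mathbb{D}$ and $h(0)=g(0)=0$. The convolution of $f_1=h_1+\overline{g_1}$ and $f_2=h_2+\overline{g_2}$ is $f_1*f_2=h_1*h_2+\overline{g_1*g_2}$, where $\big(\sum_n a_nz^n\big)*\big(\sum_n A_nz^n\big)=\sum_n a_nA_nz^n$. Let $$f_0(z)=h_0(z)+\overline{g_0(z)}=\frac{z-\frac12 z^2}{(1-z)^2}-\overline{\frac{\frac12 z^2}{(1-z)^2}}$$ be the canonical harmonic right half-plane mapping. Theorem. Let $\frac{\pi}{2}\le\alpha<\pi$, $\theta\in\mathbb{R}$, and let $f=h+\overline{g}\in K_H^O$ satisfy, for all $z\in\mathbb{D}$,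 $$h(z)+g(z)=\frac{1}{2i\sin\alpha}\log\left(\frac{1+ze^{i\alpha}}{1+ze^{-i\alpha}}\right)\quad\text{and}\quad \omega(z)=\frac{g'(z)}{h'(z)}=e^{i\theta}z^n,$$ where $\log$ is the principal branch. If $n=1$ or $n=2$, then $f_0*f\in S_H^O$, and $f_0*f$ is convex in the direction of the real axis, that is, the intersection of $(f_0*f)(\mathbb{D})$ with every horizontal line is convex (connected or empty). -/

import Mathlib

noncomputable section

namespace HarmonicConvolution

/-- The open unit disk in the complex plane. -/
def unitDisk : Set ℂ := Metric.ball (0 : ℂ) 1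

/-- The Wirtinger derivative `∂f/∂z = (∂f/∂x - i ∂f/∂y) / 2`. -/
def wirtinger (f : ℂ → ℂ) (z : ℂ) : ℂ :=
  (fderiv ℝ f z 1 - Complex.I * fderiv ℝ f z Complex.I) / 2

/-- The Wirtinger derivative `∂f/∂z̄ = (∂f/∂x + i ∂f/∂y) / 2`. -/
def wirtingerBar (f : ℂ → ℂ) (z : ℂ) : ℂ :=
  (fderiv ℝ f z 1 + Complex.I * fderiv ℝ f z Complex.I) / 2

/-- The class of complex-valued harmonic, sense-preserving, univalent functions on the unit disk,
normalized by `f(0) = 0`, `f_z(0) = 1`, `f_z̄(0) = 0`. Sense-preserving means that the Jacobian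
`|f_z|² - |f_z̄|²` is positive. -/
structure ClassSHO (f : ℂ → ℂ) : Prop where
  harmonic : InnerProductSpace.HarmonicOnNhd f unitDisk
  sensePreserving : ∀ z ∈ unitDisk, ‖wirtingerBar f z‖ < ‖wirtinger f z‖
  univalent : Set.InjOn f unitDisk
  map_zero : f 0 = 0
  wirtinger_zero : wirtinger f 0 = 1
  wirtingerBar_zero : wirtingerBar f 0 = 0

/-- The functions of the class `ClassSHO` that map the unit disk onto a convex domain. -/
structure ClassKHO (f : ℂ → ℂ) : Prop extends ClassSHO f where
  convex_image : Convex ℝ (f '' unitDisk)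

/-- A set is convex in the direction of the real axis if it contains the segment between any two
of its points that lie on a common horizontal line. -/
def ConvexInRealDirection (Ω : Set ℂ) : Prop :=
  ∀ w₁ ∈ Ω, ∀ w₂ ∈ Ω, w₁.im = w₂.im → segment ℝ w₁ w₂ ⊆ Ω

/-- The function `h + conj g`. -/
def harmonicOf (h g : ℂ → ℂ) (z : ℂ) : ℂ := h z + (starRingEnd ℂ) (g z)

/-- `h` and `g` are analytic in the unit disk and vanish at `0`: the convention that makes the
representation `f = h + conj g` of a harmonic function with `f(0) = 0` unique. -/
structure IsCanonicalPair (h g : ℂ → ℂ) : Prop where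
  analytic_left : AnalyticOnNhd ℂ h unitDisk
  analytic_right : AnalyticOnNhd ℂ g unitDisk
  left_zero : h 0 = 0
  right_zero : g 0 = 0

/-- The dilatation `ω = g' / h'` of `h + conj g`. -/
def dilatation (h g : ℂ → ℂ) (z : ℂ) : ℂ := deriv g z / deriv h z

/-- The `n`-th Taylor coefficient of `h` at `0`. -/
def taylorCoeff (h : ℂ → ℂ) (n : ℕ) : ℂ := iteratedDeriv n h 0 / (n.factorial : ℂ)

/-- The convolution (Hadamard product) of two functions that are analytic at `0`. -/
def hadamard (h H : ℂ → ℂ) (z : ℂ) : ℂ := ∑' n : ℕ, taylorCoeff h n * taylorCoeff H n * z ^ n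

/-- The harmonic convolution `(h₁ + conj g₁) * (h₂ + conj g₂) = h₁ * h₂ + conj (g₁ * g₂)`. -/
def harmonicConv (h₁ g₁ h₂ g₂ : ℂ → ℂ) : ℂ → ℂ :=
  harmonicOf (hadamard h₁ h₂) (hadamard g₁ g₂)

/-- The analytic part of the canonical right half-plane mapping `f₀ = h₀ + conj g₀`. -/
def h₀ (z : ℂ) : ℂ := (z - z ^ 2 / 2) / (1 - z) ^ 2

/-- The co-analytic part of the canonical right half-plane mapping `f₀ = h₀ + conj g₀`. -/
def g₀ (z : ℂ) : ℂ := -((z ^ 2 / 2) / (1 - z) ^ 2)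

/-- The analytic vertical strip mapping. For `|z| < 1` the quotient avoids the closed negative real
axis, so the principal logarithm is the analytic branch that vanishes at `z = 0`. -/
def verticalStripMap (α : ℝ) (z : ℂ) : ℂ :=
  1 / (2 * Complex.I * (Real.sin α : ℂ)) *
    Complex.log ((1 + z * Complex.exp ((α : ℂ) * Complex.I)) /
      (1 + z * Complex.exp (-((α : ℂ) * Complex.I))))

end HarmonicConvolution

end

noncomputable section

namespace HarmonicConvolution

open Filter Topology Set

/-! Since `h₀` and `g₀` are half the sum and half the difference of `z/(1-z)` and `z/(1-z)²`, the
convolution is `H + conj G` with `H = (h + z h')/2` and `G = (g - z g')/2`. Write `ω = c zⁿ`, `D =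
(1 + e^{iα}z)(1 + e^{-iα}z)`, `R = (1 - z²)/D` and `p = (1 - ω)/(1 + ω)`; both `R` and `p` have
positive real part on the disk. Logarithmic differentiation of `h' (1 + ω) D = 1`
(`mul_deriv_deriv`) gives `H' = (h'/2)(R + 1 - n(1 - p)/2)` and `G' = -(h'/2) ω (R - 1 + n(1 +
p)/2)`. For `n = 1` the brackets are `u + 1/2` and `u - 1/2` with `u = R + p/2`; for `n = 2` both
equal `R + p`. Hence `|G'| < |H'|`. Moreover `(H' - G') D = (R + p)/2` for every `n`.

Univalence and convexity come from a direct shear argument. Let `Z` be the inverse of the strip map,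
so `Z' = D(Z)`, and put `F = (H + conj G) ∘ Z`. On a vertical line of the strip, `Im F` has
derivative `Re (R + p)/2`, bounded below by a positive constant (`sin_div_sin_le_re`), so it takes
each real value exactly once. Each level set of `Im F` is therefore a graph over the whole base
interval, and positivity of the Jacobian makes `Re F` strictly increasing along it
(`strictMonoOn_re`). So `F` is injective and its horizontal slices are intervals. -/

/-- The real-linear map `t ↦ A t + conj (B t)`, the general form of a real-linear endomorphism
of `ℂ`. -/
def harmonicDifferential (A B : ℂ) : ℂ →L[ℝ] ℂ :=
  (ContinuousLinearMap.mul ℝ ℂ A) +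
    Complex.conjCLE.toContinuousLinearMap.comp (ContinuousLinearMap.mul ℝ ℂ B)

@[simp] theorem harmonicDifferential_apply (A B t : ℂ) :
    harmonicDifferential A B t = A * t + (starRingEnd ℂ) (B * t) := by
  simp [harmonicDifferential]

/-- The uniform bound `c` forces `V` to tend to `±∞` at both ends; mere positivity of the derivative
would not give surjectivity. -/
theorem exists_im_eq_of_deriv_ge {V V' : ℝ → ℝ} {c : ℝ} (hc : 0 < c)
    (hV : ∀ y, HasDerivAt V (V' y) y) (hV' : ∀ y, c ≤ V' y) (v : ℝ) : ∃ y, V y = v := by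
  have hdiff : Differentiable ℝ V := fun y => (hV y).differentiableAt
  have key : ∀ y₁ y₂, y₁ ≤ y₂ → c * (y₂ - y₁) ≤ V y₂ - V y₁ := by
    intro y₁ y₂ h
    exact mul_sub_le_image_sub_of_le_deriv hdiff (fun y => by rw [(hV y).deriv]; exact hV' y) h
  have htop : Tendsto V atTop atTop := by
    refine tendsto_atTop_mono' _ ?_
      (tendsto_atTop_add_const_right atTop (V 0) (tendsto_id.const_mul_atTop hc))
    filter_upwards [eventually_ge_atTop 0] with y hy
    have := key 0 y hy
    simp only [id]
    linarith
  have hbot : Tendsto V atBot atBot := by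
    refine tendsto_atBot_mono' _ ?_
      (tendsto_atBot_add_const_right atBot (V 0) (tendsto_id.const_mul_atBot hc))
    filter_upwards [eventually_le_atBot 0] with y hy
    have := key y 0 hy
    simp only [id]
    linarith
  exact hdiff.continuous.surjective htop hbot v

theorem hasDerivAt_im_vertical {F : ℂ → ℂ} {A B : ℂ} {x y : ℝ}
    (hF : HasFDerivAt F (harmonicDifferential A B) (x + y * Complex.I)) :
    HasDerivAt (fun t : ℝ => (F (x + t * Complex.I)).im) (A - B).re y := by
  have h1 : HasDerivAt (fun t : ℝ => (x + t * Complex.I : ℂ)) Complex.I y := by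
    simpa using ((Complex.ofRealCLM.hasDerivAt (x := y)).mul_const Complex.I).const_add (x : ℂ)
  have h2 := Complex.imCLM.hasFDerivAt.comp_hasDerivAt y (hF.comp_hasDerivAt y h1)
  refine h2.congr_deriv ?_
  simp
  ring

/-- Two real-linear conditions determine the direction of a level curve of the imaginary part. -/
theorem injective_re_prod_im_harmonicDifferential {A B : ℂ} (h : 0 < (A - B).re) :
    Function.Injective
      (Complex.reCLM.prod (Complex.imCLM.comp (harmonicDifferential A B))) := by
  refine (injective_iff_map_eq_zero _).2 fun t ht => ?_
  simp only [ContinuousLinearMap.prod_apply, Prod.mk_eq_zero, Complex.reCLM_apply,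
    ContinuousLinearMap.comp_apply, Complex.imCLM_apply, harmonicDifferential_apply,
    Complex.add_im, Complex.mul_im, Complex.conj_im] at ht
  obtain ⟨h1, h2⟩ := ht
  rw [h1] at h2
  have h3 : (A - B).re * t.im = 0 := by simp only [Complex.sub_re]; linarith
  exact Complex.ext h1 ((mul_eq_zero.1 h3).resolve_left h.ne')

/-- The condition on `η` says that `1 + iη` is tangent to a level curve of the imaginary part.
Multiplying the real part of its image by `Re (A - B)` gives exactly the Jacobian `|A|² - |B|²`. -/
theorem re_harmonicDifferential_pos {A B : ℂ} {η : ℝ} (hAB : ‖B‖ < ‖A‖) (h : 0 < (A - B).re)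
    (hη : (A - B).re * η = -(A - B).im) :
    0 < (harmonicDifferential A B (1 + η * Complex.I)).re := by
  have h1 : B.re * B.re + B.im * B.im < A.re * A.re + A.im * A.im := by
    have := mul_self_lt_mul_self (norm_nonneg B) hAB
    simpa [Complex.norm_mul_self_eq_normSq, Complex.normSq_apply] using this
  have h2 : (A - B).re * (harmonicDifferential A B (1 + η * Complex.I)).re =
      A.re * A.re + A.im * A.im - (B.re * B.re + B.im * B.im) := by
    simp at hη ⊢
    linear_combination (-(A.im + B.im)) * hη
  exact pos_of_mul_pos_right (by rw [h2]; linarith) h.le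

/-- A continuous graph `x + i Y(x)` on which `Im F` is constant is differentiable where the
differential of `F` satisfies `0 < Re (A - B)`. -/
theorem hasDerivAt_levelCurve {F : ℂ → ℂ} {A B : ℂ} {Y : ℝ → ℝ} {x v η : ℝ}
    (hF : HasFDerivAt F (harmonicDifferential A B) (x + Y x * Complex.I))
    (h : 0 < (A - B).re) (hη : (A - B).re * η = -(A - B).im) (hY : ContinuousAt Y x)
    (hlev : ∀ᶠ t in 𝓝 x, (F (t + Y t * Complex.I)).im = v) :
    HasDerivAt (fun t : ℝ => (t + Y t * Complex.I : ℂ))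
      (1 + η * Complex.I) x := by
  have hcont : ContinuousAt (fun t : ℝ => (t + Y t * Complex.I : ℂ)) x := by fun_prop
  have hemb : Topology.IsEmbedding
      (Complex.reCLM.prod (Complex.imCLM.comp (harmonicDifferential A B))) :=
    (LinearMap.isClosedEmbedding_of_injective (𝕜 := ℝ)
      (f := ((Complex.reCLM.prod (Complex.imCLM.comp (harmonicDifferential A B))) : ℂ →ₗ[ℝ] ℝ × ℝ))
      (LinearMap.ker_eq_bot.2 (injective_re_prod_im_harmonicDifferential h))).isEmbedding
  have hf : HasFDerivAt (fun w : ℂ => (w.re, (F w).im))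
      (Complex.reCLM.prod (Complex.imCLM.comp (harmonicDifferential A B)))
      (x + Y x * Complex.I) :=
    Complex.reCLM.hasFDerivAt.prodMk (Complex.imCLM.hasFDerivAt.comp _ hF)
  have hh : HasFDerivAt (fun t : ℝ => (t, v))
      ((Complex.reCLM.prod (Complex.imCLM.comp (harmonicDifferential A B))).comp
        (ContinuousLinearMap.toSpanSingleton ℝ (1 + η * Complex.I : ℂ))) x := by
    refine ((hasFDerivAt_id x).prodMk (hasFDerivAt_const v x)).congr_fderiv ?_
    ext
    · simp
    · simp at hη ⊢
      linear_combination -hη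
  -- The curve is continuous and is carried by `w ↦ (Re w, Im F w)` to the smooth path `(t, v)`; an
  -- injective differential lets differentiability be pulled back, in place of the implicit function
  -- theorem.
  have := HasFDerivAt.of_comp_of_isEmbedding (g := fun t : ℝ => (t + Y t * Complex.I : ℂ))
    hcont hf hemb hh ?_
  · exact hasDerivAt_iff_hasFDerivAt.2 this
  · filter_upwards [hlev] with t ht
    simp [ht]

/-! ### Level curves of `Im F` in a vertical strip -/

section Strip

variable {a b : ℝ} {F A B : ℂ → ℂ}

/-- On every vertical line of the strip, `Im F` is an increasing bijection onto the real line. -/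
structure VerticallyExpanding (a b : ℝ) (F A B : ℂ → ℂ) : Prop where
  hasFDerivAt : ∀ w : ℂ, w.re ∈ Ioo a b → HasFDerivAt F (harmonicDifferential (A w) (B w)) w
  norm_lt : ∀ w : ℂ, w.re ∈ Ioo a b → ‖B w‖ < ‖A w‖
  exists_le_re : ∀ x ∈ Ioo a b, ∃ c > 0, ∀ w : ℂ, w.re = x → c ≤ (A w - B w).re

namespace VerticallyExpanding

variable (hE : VerticallyExpanding a b F A B)
include hE

theorem re_pos {w : ℂ} (hw : w.re ∈ Ioo a b) : 0 < (A w - B w).re := by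
  obtain ⟨c, hc, h⟩ := hE.exists_le_re _ hw
  exact hc.trans_le (h w rfl)

theorem hasDerivAt_im {x : ℝ} (hx : x ∈ Ioo a b) (y : ℝ) :
    HasDerivAt (fun t : ℝ => (F (x + t * Complex.I)).im)
      (A (x + y * Complex.I) - B (x + y * Complex.I)).re y :=
  hasDerivAt_im_vertical (hE.hasFDerivAt _ (by simpa using hx))

theorem strictMono_im {x : ℝ} (hx : x ∈ Ioo a b) :
    StrictMono (fun t : ℝ => (F (x + t * Complex.I)).im) :=
  strictMono_of_deriv_pos fun y => by
    rw [(hE.hasDerivAt_im hx y).deriv]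
    exact hE.re_pos (by simpa using hx)

theorem exists_im_eq {x : ℝ} (hx : x ∈ Ioo a b) (v : ℝ) :
    ∃ y : ℝ, (F (x + y * Complex.I)).im = v := by
  obtain ⟨c, hc, h⟩ := hE.exists_le_re x hx
  exact exists_im_eq_of_deriv_ge hc (fun y => hE.hasDerivAt_im hx y) (fun y => h _ (by simp)) v

theorem continuousAt_of_im_eq {Y : ℝ → ℝ} {v : ℝ}
    (hY : ∀ x ∈ Ioo a b, (F (x + Y x * Complex.I)).im = v) {x : ℝ} (hx : x ∈ Ioo a b) :
    ContinuousAt Y x := by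
  have hnhds : ∀ᶠ t in 𝓝 x, t ∈ Ioo a b := isOpen_Ioo.mem_nhds hx
  have hcont : ∀ y : ℝ, ContinuousAt (fun t : ℝ => (F (t + y * Complex.I)).im) x := by
    intro y
    have h1 : ContinuousAt F ((x : ℂ) + y * Complex.I) :=
      (hE.hasFDerivAt _ (by simpa using hx)).continuousAt
    have h2 : ContinuousAt (fun t : ℝ => (t + y * Complex.I : ℂ)) x := by fun_prop
    exact Complex.continuous_im.continuousAt.comp (ContinuousAt.comp (f := fun t : ℝ =>
      (t + y * Complex.I : ℂ)) h1 h2)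
  -- A height `y` on one side of `Y x` has `Im F` strictly on one side of `v`. This persists at
  -- nearby abscissas, and monotonicity there puts `y` on the same side of `Y t`.
  refine tendsto_order.2 ⟨fun y hy => ?_, fun y hy => ?_⟩
  · have h1 : (F (x + y * Complex.I)).im < v := by
      rw [← hY x hx]; exact hE.strictMono_im hx hy
    filter_upwards [hnhds, (hcont y).eventually_lt_const h1] with t ht ht'
    rw [← hY t ht] at ht'
    exact (hE.strictMono_im ht).lt_iff_lt.1 ht'
  · have h1 : v < (F (x + y * Complex.I)).im := by
      rw [← hY x hx]; exact hE.strictMono_im hx hy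
    filter_upwards [hnhds, (hcont y).eventually_const_lt h1] with t ht ht'
    rw [← hY t ht] at ht'
    exact (hE.strictMono_im ht).lt_iff_lt.1 ht'

/-- Along a level curve of `Im F` the real part of `F` is strictly increasing. -/
theorem strictMonoOn_re {Y : ℝ → ℝ} {v : ℝ}
    (hY : ∀ x ∈ Ioo a b, (F (x + Y x * Complex.I)).im = v) :
    ContinuousOn (fun x : ℝ => (F (x + Y x * Complex.I)).re) (Ioo a b) ∧
      StrictMonoOn (fun x : ℝ => (F (x + Y x * Complex.I)).re) (Ioo a b) := by
  have hd : ∀ x ∈ Ioo a b, ∃ d > 0,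
      HasDerivAt (fun x : ℝ => (F (x + Y x * Complex.I)).re) d x := by
    intro x hx
    have hx' : ((x : ℂ) + Y x * Complex.I).re ∈ Ioo a b := by simpa using hx
    obtain ⟨η, hη⟩ : ∃ η : ℝ, (A (x + Y x * Complex.I) - B (x + Y x * Complex.I)).re * η =
        -(A (x + Y x * Complex.I) - B (x + Y x * Complex.I)).im :=
      ⟨_, mul_div_cancel₀ _ (hE.re_pos hx').ne'⟩
    have h1 := hasDerivAt_levelCurve (hE.hasFDerivAt _ hx') (hE.re_pos hx') hη
      (hE.continuousAt_of_im_eq hY hx)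
      (by filter_upwards [isOpen_Ioo.mem_nhds hx] with t ht using hY t ht)
    have h2 := (hE.hasFDerivAt _ hx').comp_hasDerivAt x h1
    exact ⟨_, re_harmonicDifferential_pos (hE.norm_lt _ hx') (hE.re_pos hx') hη,
      Complex.reCLM.hasFDerivAt.comp_hasDerivAt x h2⟩
  have hcont : ContinuousOn (fun x : ℝ => (F (x + Y x * Complex.I)).re) (Ioo a b) := by
    intro x hx
    obtain ⟨d, -, h⟩ := hd x hx
    exact h.continuousAt.continuousWithinAt
  refine ⟨hcont, strictMonoOn_of_deriv_pos (convex_Ioo a b) hcont fun x hx => ?_⟩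
  obtain ⟨d, hd0, h⟩ := hd x (by simpa using hx)
  rwa [h.deriv]

theorem exists_levelCurve (v : ℝ) :
    ∃ Y : ℝ → ℝ, ∀ x ∈ Ioo a b, (F (x + Y x * Complex.I)).im = v := by
  classical
  refine ⟨fun x => if hx : x ∈ Ioo a b then (hE.exists_im_eq hx v).choose else 0, fun x hx => ?_⟩
  simp only [hx, dif_pos]
  exact (hE.exists_im_eq hx v).choose_spec

theorem eq_levelCurve {Y : ℝ → ℝ} {v : ℝ}
    (hY : ∀ x ∈ Ioo a b, (F (x + Y x * Complex.I)).im = v) {w : ℂ} (hw : w.re ∈ Ioo a b)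
    (hv : (F w).im = v) : w = w.re + Y w.re * Complex.I := by
  have h : w.im = Y w.re := by
    refine (hE.strictMono_im hw).injective ?_
    simp only [Complex.re_add_im]
    rw [hY _ hw, hv]
  rw [← h, Complex.re_add_im]

/-- Two points with equal image lie on the same level curve, where `Re F` separates abscissas. -/
theorem injOn : InjOn F {w | w.re ∈ Ioo a b} := by
  intro w₁ h₁ w₂ h₂ h
  obtain ⟨Y, hY⟩ := hE.exists_levelCurve (F w₁).im
  have e₁ := hE.eq_levelCurve hY h₁ rfl
  have e₂ := hE.eq_levelCurve hY h₂ (by rw [h])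
  have : w₁.re = w₂.re := by
    refine (hE.strictMonoOn_re hY).2.injOn h₁ h₂ ?_
    rw [← e₁, ← e₂, h]
  rw [e₁, e₂, this]

/-- A horizontal slice of the image is the continuous image under `Re F` of one level curve over an
interval, hence order connected. -/
theorem convexInRealDirection_image : ConvexInRealDirection (F '' {w | w.re ∈ Ioo a b}) := by
  rintro _ ⟨w₁, h₁, rfl⟩ _ ⟨w₂, h₂, rfl⟩ him p hp
  obtain ⟨Y, hY⟩ := hE.exists_levelCurve (F w₁).im
  have e₁ := hE.eq_levelCurve hY h₁ rfl
  have e₂ := hE.eq_levelCurve hY h₂ him.symm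
  have hconn : (((fun x : ℝ => (F (x + Y x * Complex.I)).re) '' Ioo a b)).OrdConnected :=
    (isPreconnected_Ioo.image _ (hE.strictMonoOn_re hY).1).ordConnected
  have m₁ : (F w₁).re ∈ (fun x : ℝ => (F (x + Y x * Complex.I)).re) '' Ioo a b :=
    ⟨_, h₁, by simp only; rw [← e₁]⟩
  have m₂ : (F w₂).re ∈ (fun x : ℝ => (F (x + Y x * Complex.I)).re) '' Ioo a b :=
    ⟨_, h₂, by simp only; rw [← e₂]⟩
  obtain ⟨s, t, hs, ht, hst, rfl⟩ := hp
  obtain ⟨x, hx, hxe⟩ := hconn.convex m₁ m₂ hs ht hst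
  refine ⟨x + Y x * Complex.I, by simpa using hx, Complex.ext ?_ ?_⟩
  · simpa using hxe
  · rw [hY x hx]
    simp only [Complex.add_im, Complex.real_smul, Complex.im_ofReal_mul, ← him]
    rw [← add_mul, hst, one_mul]

end VerticallyExpanding

end Strip

theorem isOpen_unitDisk : IsOpen unitDisk := Metric.isOpen_ball

theorem mem_unitDisk {z : ℂ} : z ∈ unitDisk ↔ ‖z‖ < 1 := by simp [unitDisk]

/-! ### Wirtinger derivatives of `h + conj g` -/

section Harmonic

variable {h g : ℂ → ℂ} {z : ℂ}

theorem hasFDerivAt_harmonicOf (hh : DifferentiableAt ℂ h z) (hg : DifferentiableAt ℂ g z) :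
    HasFDerivAt (harmonicOf h g) (harmonicDifferential (deriv h z) (deriv g z)) z := by
  have h1 := hh.hasDerivAt.hasFDerivAt.restrictScalars ℝ
  have h2 := Complex.conjCLE.toContinuousLinearMap.hasFDerivAt.comp z
    (hg.hasDerivAt.hasFDerivAt.restrictScalars ℝ)
  refine (h1.add h2).congr_fderiv ?_
  ext
  simp [mul_comm]

theorem wirtinger_harmonicOf (hh : DifferentiableAt ℂ h z) (hg : DifferentiableAt ℂ g z) :
    wirtinger (harmonicOf h g) z = deriv h z := by
  rw [wirtinger, (hasFDerivAt_harmonicOf hh hg).fderiv]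
  simp only [harmonicDifferential_apply, mul_one, map_mul, Complex.conj_I]
  linear_combination (-(deriv h z) / 2 + (starRingEnd ℂ) (deriv g z) / 2) * Complex.I_mul_I

theorem wirtingerBar_harmonicOf (hh : DifferentiableAt ℂ h z) (hg : DifferentiableAt ℂ g z) :
    wirtingerBar (harmonicOf h g) z = (starRingEnd ℂ) (deriv g z) := by
  rw [wirtingerBar, (hasFDerivAt_harmonicOf hh hg).fderiv]
  simp only [harmonicDifferential_apply, mul_one, map_mul, Complex.conj_I]
  linear_combination ((deriv h z) / 2 - (starRingEnd ℂ) (deriv g z) / 2) * Complex.I_mul_I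

theorem harmonicAt_harmonicOf (hh : AnalyticAt ℂ h z) (hg : AnalyticAt ℂ g z) :
    InnerProductSpace.HarmonicAt (harmonicOf h g) z :=
  hh.harmonicAt.add hg.harmonicAt_conj

/-- Criterion for membership in `ClassSHO` in terms of an analytic decomposition. -/
theorem classSHO_of_eqOn {f : ℂ → ℂ} (hf : EqOn f (harmonicOf h g) unitDisk)
    (hpair : IsCanonicalPair h g) (hlt : ∀ z ∈ unitDisk, ‖deriv g z‖ < ‖deriv h z‖)
    (hinj : InjOn f unitDisk) (h1 : deriv h 0 = 1) (g1 : deriv g 0 = 0) : ClassSHO f := by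
  have h0 : (0 : ℂ) ∈ unitDisk := by simp [mem_unitDisk]
  have hev : ∀ z ∈ unitDisk, f =ᶠ[𝓝 z] harmonicOf h g := fun z hz =>
    hf.eventuallyEq_of_mem (isOpen_unitDisk.mem_nhds hz)
  have hw : ∀ z ∈ unitDisk, wirtinger f z = deriv h z := fun z hz => by
    rw [← wirtinger_harmonicOf (hpair.analytic_left z hz).differentiableAt
      (hpair.analytic_right z hz).differentiableAt, wirtinger, wirtinger, (hev z hz).fderiv_eq]
  have hw' : ∀ z ∈ unitDisk, wirtingerBar f z = (starRingEnd ℂ) (deriv g z) := fun z hz => by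
    rw [← wirtingerBar_harmonicOf (hpair.analytic_left z hz).differentiableAt
      (hpair.analytic_right z hz).differentiableAt, wirtingerBar, wirtingerBar,
      (hev z hz).fderiv_eq]
  refine ⟨fun z hz => ?_, fun z hz => ?_, hinj, ?_, ?_, ?_⟩
  · exact (InnerProductSpace.harmonicAt_congr_nhds (hev z hz)).2
      (harmonicAt_harmonicOf (hpair.analytic_left z hz) (hpair.analytic_right z hz))
  · rw [hw z hz, hw' z hz, RCLike.norm_conj]
    exact hlt z hz
  · rw [hf h0]
    simp [harmonicOf, hpair.left_zero, hpair.right_zero]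
  · rw [hw 0 h0, h1]
  · rw [hw' 0 h0, g1, map_zero]

end Harmonic

/-! ### Convolution with `h₀` and `g₀` as differential operators -/

section Hadamard

theorem taylorCoeff_eq_of_hasSum {f : ℂ → ℂ} {c : ℕ → ℂ}
    (hf : ∀ z ∈ unitDisk, HasSum (fun n => c n * z ^ n) (f z)) (n : ℕ) :
    taylorCoeff f n = c n := by
  have h1 : HasFPowerSeriesAt f (FormalMultilinearSeries.ofScalars ℂ c) 0 := by
    rw [hasFPowerSeriesAt_iff']
    filter_upwards [isOpen_unitDisk.mem_nhds (by simp [mem_unitDisk] : (0 : ℂ) ∈ unitDisk)]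
      with z hz
    simpa [FormalMultilinearSeries.coeff_ofScalars, mul_comm] using hf z hz
  have h2 := h1.analyticAt.hasFPowerSeriesAt.eq_formalMultilinearSeries h1
  have h3 := congrArg (fun p => FormalMultilinearSeries.coeff p n) h2
  simpa [FormalMultilinearSeries.coeff_ofScalars, taylorCoeff] using h3

theorem hasSum_taylorCoeff {h : ℂ → ℂ} (hh : AnalyticOnNhd ℂ h unitDisk) {z : ℂ}
    (hz : z ∈ unitDisk) : HasSum (fun n => taylorCoeff h n * z ^ n) (h z) := by
  have := Complex.hasSum_taylorSeries_on_ball hh.differentiableOn hz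
  refine this.congr_fun fun n => ?_
  simp only [taylorCoeff, sub_zero, smul_eq_mul]
  ring

theorem hasSum_nat_mul_taylorCoeff {h : ℂ → ℂ} (hh : AnalyticOnNhd ℂ h unitDisk) {z : ℂ}
    (hz : z ∈ unitDisk) :
    HasSum (fun n : ℕ => n * (taylorCoeff h n * z ^ n)) (z * deriv h z) := by
  have h1 := (hasSum_taylorCoeff hh.deriv hz).mul_left z
  have h2 : HasSum (fun n : ℕ => ((n + 1 : ℕ) : ℂ) * (taylorCoeff h (n + 1) * z ^ (n + 1)))
      (z * deriv h z) := by
    refine h1.congr_fun fun n => ?_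
    have : ((n : ℂ) + 1) ≠ 0 := by exact_mod_cast n.succ_ne_zero
    have h' : ((n.factorial : ℕ) : ℂ) ≠ 0 := by exact_mod_cast n.factorial_ne_zero
    simp only [taylorCoeff, iteratedDeriv_succ', Nat.factorial_succ]
    push_cast
    field_simp
    ring
  -- The index shift by one costs nothing because the term at `n = 0` vanishes.
  simpa using (hasSum_nat_add_iff (f := fun n : ℕ => (n : ℂ) * (taylorCoeff h n * z ^ n)) 1).1 h2

theorem hasSum_indicator_zero (z : ℂ) :
    HasSum (fun n : ℕ => (if n = 0 then (1 : ℂ) else 0) * z ^ n) 1 := by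
  simpa using hasSum_single (f := fun n : ℕ => (if n = 0 then (1 : ℂ) else 0) * z ^ n) 0
    (fun n hn => by simp [hn])

theorem hasSum_succ_mul_geometric {z : ℂ} (hz : ‖z‖ < 1) :
    HasSum (fun n : ℕ => ((n : ℂ) + 1) * z ^ n) (1 / (1 - z) ^ 2) := by
  simpa using hasSum_choose_mul_geometric_of_norm_lt_one 1 hz

theorem one_sub_ne_zero_of_mem_unitDisk {z : ℂ} (hz : z ∈ unitDisk) : 1 - z ≠ 0 := by
  rintro h
  rw [mem_unitDisk, ← sub_eq_zero.1 h] at hz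
  simp at hz

theorem taylorCoeff_h₀ (n : ℕ) :
    taylorCoeff h₀ n = ((n : ℂ) + 1) / 2 - (if n = 0 then 1 else 0) / 2 := by
  refine taylorCoeff_eq_of_hasSum (c := fun n : ℕ =>
    ((n : ℂ) + 1) / 2 - (if n = 0 then 1 else 0) / 2) (fun z hz => ?_) n
  have h1 := ((hasSum_succ_mul_geometric (mem_unitDisk.1 hz)).sub
    (hasSum_indicator_zero z)).div_const 2
  have hne := one_sub_ne_zero_of_mem_unitDisk hz
  have h2 : h₀ z = (1 / (1 - z) ^ 2 - 1) / 2 := by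
    rw [h₀.eq_def]
    field_simp
    ring
  rw [h2]
  exact h1.congr_fun fun n => by ring

theorem taylorCoeff_g₀ (n : ℕ) :
    taylorCoeff g₀ n = (1 - (n : ℂ)) / 2 - (if n = 0 then 1 else 0) / 2 := by
  refine taylorCoeff_eq_of_hasSum (c := fun n : ℕ =>
    (1 - (n : ℂ)) / 2 - (if n = 0 then 1 else 0) / 2) (fun z hz => ?_) n
  have h1 := ((((hasSum_geometric_of_norm_lt_one (mem_unitDisk.1 hz)).mul_left 2).sub
    (hasSum_succ_mul_geometric (mem_unitDisk.1 hz))).sub (hasSum_indicator_zero z)).div_const 2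
  have hne := one_sub_ne_zero_of_mem_unitDisk hz
  have h2 : g₀ z = (2 * (1 - z)⁻¹ - 1 / (1 - z) ^ 2 - 1) / 2 := by
    rw [g₀.eq_def]
    field_simp
    ring
  rw [h2]
  exact h1.congr_fun fun n => by ring

theorem hadamard_h₀ {h : ℂ → ℂ} (hh : AnalyticOnNhd ℂ h unitDisk) (h0 : h 0 = 0) {z : ℂ}
    (hz : z ∈ unitDisk) : hadamard h₀ h z = (h z + z * deriv h z) / 2 := by
  refine HasSum.tsum_eq ?_
  refine (((hasSum_taylorCoeff hh hz).add (hasSum_nat_mul_taylorCoeff hh hz)).div_const 2).congr_fun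
    fun n => ?_
  rw [taylorCoeff_h₀]
  -- At `n = 0` the coefficient `(n + 1)/2` carries a correction, but `h 0 = 0` kills that term.
  rcases n with _ | n
  · simp [taylorCoeff, h0]
  · simp
    ring

theorem hadamard_g₀ {g : ℂ → ℂ} (hg : AnalyticOnNhd ℂ g unitDisk) (h0 : g 0 = 0) {z : ℂ}
    (hz : z ∈ unitDisk) : hadamard g₀ g z = (g z - z * deriv g z) / 2 := by
  refine HasSum.tsum_eq ?_
  refine (((hasSum_taylorCoeff hg hz).sub (hasSum_nat_mul_taylorCoeff hg hz)).div_const 2).congr_fun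
    fun n => ?_
  rw [taylorCoeff_g₀]
  rcases n with _ | n
  · simp [taylorCoeff, h0]
  · simp
    ring

end Hadamard

/-! ### Cayley transforms and the strip denominator -/

/-- The unimodular number `e^{iα}`. -/
def unimodular (α : ℝ) : ℂ := Complex.exp (α * Complex.I)

section Unimodular

variable (α : ℝ)

theorem conj_unimodular : (starRingEnd ℂ) (unimodular α) = unimodular (-α) := by
  simp [unimodular, ← Complex.exp_conj]

theorem norm_unimodular : ‖unimodular α‖ = 1 := Complex.norm_exp_ofReal_mul_I α

theorem unimodular_mul_neg : unimodular α * unimodular (-α) = 1 := by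
  simp [unimodular, ← Complex.exp_add]

theorem unimodular_sub_neg :
    unimodular α - unimodular (-α) = 2 * Complex.I * (Real.sin α : ℂ) := by
  simp only [unimodular, Complex.exp_mul_I, Complex.ofReal_neg, Complex.cos_neg, Complex.sin_neg,
    Complex.ofReal_sin]
  ring

theorem one_add_unimodular_mul_ne_zero {z : ℂ} (hz : z ∈ unitDisk) :
    1 + unimodular α * z ≠ 0 := by
  intro h
  have h1 : ‖unimodular α * z‖ = 1 := by
    rw [eq_neg_of_add_eq_zero_right h]; simp
  rw [norm_mul, norm_unimodular, one_mul] at h1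
  exact absurd (mem_unitDisk.1 hz) (by simp [h1])

end Unimodular

theorem re_one_sub_div_one_add_pos {u : ℂ} (hu : ‖u‖ < 1) : 0 < ((1 - u) / (1 + u)).re := by
  have hne : 1 + u ≠ 0 := by
    intro h
    rw [eq_neg_of_add_eq_zero_right h] at hu
    simp at hu
  have h1 : Complex.normSq u < 1 := by
    rw [Complex.normSq_eq_norm_sq]
    exact pow_lt_one₀ (norm_nonneg u) hu two_ne_zero
  rw [Complex.normSq_apply] at h1
  rw [Complex.div_re, ← add_div]
  refine div_pos ?_ (Complex.normSq_pos.2 hne)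
  simp
  nlinarith

/-- The denominator of the derivative of the vertical strip mapping. -/
def stripDenom (α : ℝ) (z : ℂ) : ℂ := (1 + unimodular α * z) * (1 + unimodular (-α) * z)

theorem stripDenom_ne_zero (α : ℝ) {z : ℂ} (hz : z ∈ unitDisk) : stripDenom α z ≠ 0 :=
  mul_ne_zero (one_add_unimodular_mul_ne_zero α hz) (one_add_unimodular_mul_ne_zero (-α) hz)

/-- This average of two Cayley transforms, each mapping the disk to the right half-plane, is the
source of the positivity of `Re R`. -/
theorem one_sub_sq_div_stripDenom (α : ℝ) {z : ℂ} (hz : z ∈ unitDisk) :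
    (1 - z ^ 2) / stripDenom α z =
      ((1 - unimodular α * z) / (1 + unimodular α * z) +
        (1 - unimodular (-α) * z) / (1 + unimodular (-α) * z)) / 2 := by
  have h1 := one_add_unimodular_mul_ne_zero α hz
  have h2 := one_add_unimodular_mul_ne_zero (-α) hz
  rw [stripDenom, div_add_div _ _ h1 h2, div_div,
    div_eq_div_iff (mul_ne_zero h1 h2) (mul_ne_zero (mul_ne_zero h1 h2) two_ne_zero)]
  linear_combination 2 * z ^ 2 * (1 + unimodular α * z) * (1 + unimodular (-α) * z) *
    unimodular_mul_neg α

theorem re_one_sub_sq_div_stripDenom_pos (α : ℝ) {z : ℂ} (hz : z ∈ unitDisk) :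
    0 < ((1 - z ^ 2) / stripDenom α z).re := by
  have key : ∀ β : ℝ, 0 < ((1 - unimodular β * z) / (1 + unimodular β * z)).re := fun β =>
    re_one_sub_div_one_add_pos (by
      rw [norm_mul, norm_unimodular, one_mul]
      exact mem_unitDisk.1 hz)
  rw [one_sub_sq_div_stripDenom α hz, Complex.div_ofNat_re, Complex.add_re]
  have := key α
  have := key (-α)
  positivity

/-! ### The vertical strip map and its half-plane of exponentials -/

section HalfPlane

variable {α : ℝ}

theorem sub_unimodular_mul_ne_zero (hs : 0 < Real.sin α) {E : ℂ}
    (hE : (E * unimodular (-α)).im < 0) : unimodular α - unimodular (-α) * E ≠ 0 := by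
  intro h
  rw [mul_comm E, ← sub_eq_zero.1 h] at hE
  rw [unimodular, Complex.exp_ofReal_mul_I_im] at hE
  linarith

/-- The right side equals `|e^{2iα} - E|`. The perpendicular bisector of `1` and `e^{2iα}` is the
line through `0` and `e^{iα}`, and the sign hypothesis puts `E` on the side of `1`. -/
theorem norm_sub_one_lt (hs : 0 < Real.sin α) {E : ℂ} (hE : (E * unimodular (-α)).im < 0) :
    ‖E - 1‖ < ‖unimodular α - unimodular (-α) * E‖ := by
  have h1 : unimodular α = ⟨Real.cos α, Real.sin α⟩ := by
    apply Complex.ext <;> simp [unimodular, Complex.exp_ofReal_mul_I_re, Complex.exp_ofReal_mul_I_im]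
  have h2 : unimodular (-α) = ⟨Real.cos α, -Real.sin α⟩ := by
    rw [← conj_unimodular, h1]; rfl
  have h3 := Real.sin_sq_add_cos_sq α
  refine lt_of_pow_lt_pow_left₀ 2 (norm_nonneg _) ?_
  rw [h2] at hE
  rw [← Complex.normSq_eq_norm_sq, ← Complex.normSq_eq_norm_sq, Complex.normSq_apply,
    Complex.normSq_apply, h1, h2]
  simp only [Complex.sub_re, Complex.sub_im, Complex.mul_re, Complex.mul_im, Complex.one_re,
    Complex.one_im] at hE ⊢
  have h4 : 0 < -4 * Real.sin α * (E.re * -Real.sin α + E.im * Real.cos α) := by nlinarith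
  have h5 : Real.cos α ^ 2 = 1 - Real.sin α ^ 2 := by linarith
  have h6 : (Real.cos α - (Real.cos α * E.re - -Real.sin α * E.im)) *
      (Real.cos α - (Real.cos α * E.re - -Real.sin α * E.im)) +
      (Real.sin α - (Real.cos α * E.im + -Real.sin α * E.re)) *
      (Real.sin α - (Real.cos α * E.im + -Real.sin α * E.re)) =
      (E.re - 1) * (E.re - 1) + (E.im - 0) * (E.im - 0) +
      -4 * Real.sin α * (E.re * -Real.sin α + E.im * Real.cos α) := by
    linear_combination (1 + E.re ^ 2 + E.im ^ 2 - 2 * E.re) * h5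
  linarith

/-- The Möbius map taking the disk onto the half-plane of logarithms of the strip. -/
def stripQuotient (α : ℝ) (z : ℂ) : ℂ := (1 + unimodular α * z) / (1 + unimodular (-α) * z)

theorem im_stripQuotient_mul_neg (hs : 0 < Real.sin α) {z : ℂ} (hz : z ∈ unitDisk) :
    (stripQuotient α z * unimodular (-α)).im < 0 := by
  have hne := one_add_unimodular_mul_ne_zero (-α) hz
  have h1 : stripQuotient α z * unimodular (-α) =
      ((unimodular (-α) + z) * (starRingEnd ℂ) (1 + unimodular (-α) * z)) *
        ((Complex.normSq (1 + unimodular (-α) * z))⁻¹ : ℝ) := by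
    rw [stripQuotient, div_eq_mul_inv, Complex.inv_def]
    push_cast
    linear_combination (z * (starRingEnd ℂ) (1 + unimodular (-α) * z) *
      ((Complex.normSq (1 + unimodular (-α) * z) : ℂ)⁻¹)) * unimodular_mul_neg α
  rw [h1, Complex.im_mul_ofReal]
  refine mul_neg_of_neg_of_pos ?_ (inv_pos.2 (Complex.normSq_pos.2 hne))
  have h2 : unimodular (-α) = ⟨Real.cos α, -Real.sin α⟩ := by
    apply Complex.ext <;> simp [unimodular, Complex.exp_re, Complex.exp_im]
  have h3 : z.re * z.re + z.im * z.im < 1 := by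
    rw [← Complex.normSq_apply, Complex.normSq_eq_norm_sq]
    exact pow_lt_one₀ (norm_nonneg z) (mem_unitDisk.1 hz) two_ne_zero
  rw [h2]
  simp only [Complex.add_re, Complex.add_im, Complex.mul_re, Complex.mul_im, Complex.one_re,
    Complex.one_im, Complex.conj_re, Complex.conj_im]
  have h4 := Real.sin_sq_add_cos_sq α
  have h5 := mul_pos hs (sub_pos.2 h3)
  -- After clearing the positive denominator, the imaginary part is exactly `-(1 - |z|²) sin α`.
  have h6 : (Real.cos α + z.re) * -(0 + (Real.cos α * z.im + -Real.sin α * z.re)) +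
      (-Real.sin α + z.im) * (1 + (Real.cos α * z.re - -Real.sin α * z.im)) =
      -(Real.sin α * (1 - (z.re * z.re + z.im * z.im))) := by
    linear_combination (-z.im) * h4
  linarith

theorem stripQuotient_mem_slitPlane (hs : 0 < Real.sin α) {z : ℂ} (hz : z ∈ unitDisk) :
    stripQuotient α z ∈ Complex.slitPlane := by
  have h := im_stripQuotient_mul_neg hs hz
  have h2 : unimodular (-α) = ⟨Real.cos α, -Real.sin α⟩ := by
    apply Complex.ext <;> simp [unimodular, Complex.exp_re, Complex.exp_im]
  rw [h2] at h
  simp only [Complex.mul_im] at h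
  rw [Complex.mem_slitPlane_iff]
  by_contra! hcon
  rw [hcon.2] at h
  nlinarith [hcon.1]

theorem arg_stripQuotient (hα : 0 < α) (hα' : α < Real.pi) {z : ℂ} (hz : z ∈ unitDisk) :
    (stripQuotient α z).arg ∈ Ioo (α - Real.pi) α := by
  have hs := Real.sin_pos_of_pos_of_lt_pi hα hα'
  have h := im_stripQuotient_mul_neg hs hz
  set E := stripQuotient α z
  have hsl : E ≠ 0 := Complex.slitPlane_ne_zero (stripQuotient_mem_slitPlane hs hz)
  have h1 : E * unimodular (-α) = ‖E‖ * Complex.exp ((E.arg - α : ℝ) * Complex.I) := by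
    conv_lhs => rw [← Complex.norm_mul_exp_arg_mul_I E]
    rw [unimodular, mul_assoc, ← Complex.exp_add]
    congr 2
    push_cast
    ring
  rw [h1, Complex.im_ofReal_mul, Complex.exp_ofReal_mul_I_im] at h
  have h2 : Real.sin (E.arg - α) < 0 := by
    by_contra! hcon
    exact absurd h (not_lt.2 (mul_nonneg (norm_nonneg E) hcon))
  have h3 := Complex.neg_pi_lt_arg E
  have h4 := Complex.arg_le_pi E
  constructor
  -- The sine fixes `arg E - α` only modulo `2π`; the principal range of `arg` excludes the
  -- neighbouring period.
  · by_contra! hcon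
    have h5 : 0 ≤ Real.sin (E.arg - α + 2 * Real.pi) :=
      Real.sin_nonneg_of_nonneg_of_le_pi (by linarith) (by linarith)
    rw [Real.sin_add_two_pi] at h5
    linarith
  · by_contra! hcon
    have h5 : 0 ≤ Real.sin (E.arg - α) :=
      Real.sin_nonneg_of_nonneg_of_le_pi (by linarith) (by linarith)
    linarith

theorem verticalStripMap_eq (α : ℝ) (z : ℂ) : verticalStripMap α z =
    1 / (2 * Complex.I * (Real.sin α : ℂ)) * Complex.log (stripQuotient α z) := by
  simp [verticalStripMap, stripQuotient, unimodular, mul_comm z]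

theorem hasDerivAt_verticalStripMap (hs : 0 < Real.sin α) {z : ℂ} (hz : z ∈ unitDisk) :
    HasDerivAt (verticalStripMap α) (1 / stripDenom α z) z := by
  have hs' : (Real.sin α : ℂ) ≠ 0 := by exact_mod_cast hs.ne'
  have hn1 := one_add_unimodular_mul_ne_zero α hz
  have hn2 := one_add_unimodular_mul_ne_zero (-α) hz
  have hlin : ∀ β, HasDerivAt (fun z => 1 + unimodular β * z) (unimodular β) z := fun β => by
    simpa using ((hasDerivAt_id z).const_mul (unimodular β)).const_add 1
  have h1 : HasDerivAt (stripQuotient α)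
      (2 * Complex.I * (Real.sin α : ℂ) / (1 + unimodular (-α) * z) ^ 2) z := by
    refine ((hlin α).div (hlin (-α)) hn2).congr_deriv ?_
    rw [← unimodular_sub_neg]
    ring
  have h2 := (h1.clog (stripQuotient_mem_slitPlane hs hz)).const_mul
    (1 / (2 * Complex.I * (Real.sin α : ℂ)))
  refine (h2.congr_deriv ?_).congr_of_eventuallyEq
    (Eventually.of_forall fun z => verticalStripMap_eq α z)
  rw [stripQuotient, stripDenom]
  field_simp

end HalfPlane

/-! ### The inverse of the strip map, and a lower bound on vertical lines -/

section Parametrization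

variable {α : ℝ}

/-- The exponential of the strip variable. -/
def stripExp (α : ℝ) (w : ℂ) : ℂ := Complex.exp (2 * Complex.I * (Real.sin α : ℂ) * w)

/-- The inverse of the vertical strip mapping. -/
def diskParam (α : ℝ) (w : ℂ) : ℂ :=
  (stripExp α w - 1) / (unimodular α - unimodular (-α) * stripExp α w)

/-- The interval over which the image of the vertical strip mapping lies. -/
def stripBase (α : ℝ) : Set ℝ :=
  Ioo ((α - Real.pi) / (2 * Real.sin α)) (α / (2 * Real.sin α))

theorem mem_stripBase (hs : 0 < Real.sin α) {x : ℝ} :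
    x ∈ stripBase α ↔ 2 * Real.sin α * x ∈ Ioo (α - Real.pi) α := by
  have : 0 < 2 * Real.sin α := by positivity
  rw [stripBase, mem_Ioo, mem_Ioo, div_lt_iff₀' this, lt_div_iff₀' this]

theorem stripExp_mul_neg (α : ℝ) (w : ℂ) : stripExp α w * unimodular (-α) =
    (Real.exp (-(2 * Real.sin α * w.im)) : ℝ) *
      Complex.exp ((-(α - 2 * Real.sin α * w.re) : ℝ) * Complex.I) := by
  rw [stripExp, unimodular, ← Complex.exp_add, Complex.ofReal_exp, ← Complex.exp_add]
  congr 1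
  conv_lhs => rw [← Complex.re_add_im w]
  push_cast
  linear_combination (2 * Complex.sin α * w.im) * Complex.I_mul_I

theorem im_stripExp_mul_neg (hs : 0 < Real.sin α) {w : ℂ} (hw : w.re ∈ stripBase α) :
    (stripExp α w * unimodular (-α)).im < 0 := by
  rw [mem_stripBase hs] at hw
  rw [stripExp_mul_neg, Complex.im_ofReal_mul, Complex.exp_ofReal_mul_I_im, Real.sin_neg]
  have := Real.sin_pos_of_pos_of_lt_pi (x := α - 2 * Real.sin α * w.re)
    (by linarith [hw.2]) (by linarith [hw.1])
  have := Real.exp_pos (-(2 * Real.sin α * w.im))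
  nlinarith

theorem diskParam_mem (hs : 0 < Real.sin α) {w : ℂ} (hw : w.re ∈ stripBase α) :
    diskParam α w ∈ unitDisk := by
  have h := im_stripExp_mul_neg hs hw
  rw [mem_unitDisk, diskParam, norm_div,
    div_lt_one (norm_pos_iff.2 (sub_unimodular_mul_ne_zero hs h))]
  exact norm_sub_one_lt hs h

theorem surjOn_diskParam (hα : 0 < α) (hα' : α < Real.pi) :
    SurjOn (diskParam α) {w | w.re ∈ stripBase α} unitDisk := by
  intro z hz
  have hs := Real.sin_pos_of_pos_of_lt_pi hα hα'
  have hs' : (Real.sin α : ℂ) ≠ 0 := by exact_mod_cast hs.ne'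
  have hsl := stripQuotient_mem_slitPlane hs hz
  have hn2 := one_add_unimodular_mul_ne_zero (-α) hz
  have hlog : 2 * Complex.I * (Real.sin α : ℂ) * verticalStripMap α z =
      Complex.log (stripQuotient α z) := by
    rw [verticalStripMap_eq]
    field_simp
  have hE : stripExp α (verticalStripMap α z) = stripQuotient α z := by
    rw [stripExp, hlog, Complex.exp_log (Complex.slitPlane_ne_zero hsl)]
  have hre : 2 * Real.sin α * (verticalStripMap α z).re = (stripQuotient α z).arg := by
    rw [← Complex.log_im, ← hlog]
    simp only [Complex.mul_im, Complex.mul_re, Complex.I_re, Complex.I_im, Complex.ofReal_re,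
      Complex.ofReal_im, Complex.re_ofNat, Complex.im_ofNat]
    ring
  refine ⟨verticalStripMap α z, ?_, ?_⟩
  · change _ ∈ stripBase α
    rw [mem_stripBase hs, hre]
    exact arg_stripQuotient hα hα' hz
  · have hne := sub_unimodular_mul_ne_zero hs (im_stripQuotient_mul_neg hs hz)
    have hQ : stripQuotient α z * (1 + unimodular (-α) * z) = 1 + unimodular α * z :=
      div_mul_cancel₀ _ hn2
    rw [diskParam, hE, div_eq_iff hne]
    refine mul_right_cancel₀ hn2 ?_
    linear_combination (1 + unimodular (-α) * z) * hQ

theorem one_add_unimodular_mul_diskParam (hs : 0 < Real.sin α) {w : ℂ}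
    (hw : w.re ∈ stripBase α) :
    1 + unimodular α * diskParam α w = stripExp α w * (2 * Complex.I * (Real.sin α : ℂ)) /
        (unimodular α - unimodular (-α) * stripExp α w) ∧
      1 + unimodular (-α) * diskParam α w = 2 * Complex.I * (Real.sin α : ℂ) /
        (unimodular α - unimodular (-α) * stripExp α w) := by
  have hne := sub_unimodular_mul_ne_zero hs (im_stripExp_mul_neg hs hw)
  have hZ : diskParam α w * (unimodular α - unimodular (-α) * stripExp α w) = stripExp α w - 1 :=
    div_mul_cancel₀ _ hne
  rw [← unimodular_sub_neg, eq_div_iff hne, eq_div_iff hne]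
  constructor
  · linear_combination unimodular α * hZ
  · linear_combination unimodular (-α) * hZ

/-- The strip map has derivative `1 / stripDenom α z`, so its inverse satisfies the autonomous
equation `Z' = D(Z)`. -/
theorem hasDerivAt_diskParam (hs : 0 < Real.sin α) {w : ℂ} (hw : w.re ∈ stripBase α) :
    HasDerivAt (diskParam α) (stripDenom α (diskParam α w)) w := by
  have hne := sub_unimodular_mul_ne_zero hs (im_stripExp_mul_neg hs hw)
  obtain ⟨e1, e2⟩ := one_add_unimodular_mul_diskParam hs hw
  have h1 : HasDerivAt (stripExp α) (stripExp α w * (2 * Complex.I * (Real.sin α : ℂ))) w := by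
    simpa only [stripExp, id, mul_one] using!
      ((hasDerivAt_id w).const_mul (2 * Complex.I * (Real.sin α : ℂ))).cexp
  refine ((h1.sub_const 1).div ((h1.const_mul (unimodular (-α))).const_sub (unimodular α))
    hne).congr_deriv ?_
  rw [stripDenom, e1, e2, ← unimodular_sub_neg]
  field_simp
  ring

/-- In polar form `E e^{-iα} = e^{-t} e^{-iβ}`, with `t = 2 sin α Im w` and `β = α - 2 sin α Re w`,
the right side has real part `cosh t sin β / sin α`. Only `t` varies along a vertical line, and
`cosh t ≥ 1`. -/
theorem one_sub_sq_div_stripDenom_diskParam (hs : 0 < Real.sin α) {w : ℂ}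
    (hw : w.re ∈ stripBase α) :
    (1 - diskParam α w ^ 2) / stripDenom α (diskParam α w) =
      ((stripExp α w * unimodular (-α))⁻¹ - stripExp α w * unimodular (-α)) /
        (2 * Complex.I * (Real.sin α : ℂ)) := by
  have hne := sub_unimodular_mul_ne_zero hs (im_stripExp_mul_neg hs hw)
  have hs' : 2 * Complex.I * (Real.sin α : ℂ) ≠ 0 :=
    mul_ne_zero (mul_ne_zero two_ne_zero Complex.I_ne_zero) (by exact_mod_cast hs.ne')
  have hE0 : stripExp α w ≠ 0 := Complex.exp_ne_zero _
  have hinv : (unimodular (-α))⁻¹ = unimodular α :=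
    inv_eq_of_mul_eq_one_left (unimodular_mul_neg α)
  obtain ⟨e1, e2⟩ := one_add_unimodular_mul_diskParam hs hw
  rw [stripDenom, e1, e2, diskParam, mul_inv, hinv]
  have hδ := unimodular_sub_neg α
  have hab := unimodular_mul_neg α
  generalize hd : unimodular α - unimodular (-α) * stripExp α w = d at *
  generalize 2 * Complex.I * (Real.sin α : ℂ) = δ at *
  generalize stripExp α w = E at *
  field_simp
  rw [← hδ, ← hd]
  linear_combination (E - 1) ^ 2 * hab

/-- A lower bound, uniform on vertical lines, in the strip coordinate. -/
theorem sin_div_sin_le_re (hs : 0 < Real.sin α) {w : ℂ} (hw : w.re ∈ stripBase α) :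
    Real.sin (α - 2 * Real.sin α * w.re) / Real.sin α ≤
      ((1 - diskParam α w ^ 2) / stripDenom α (diskParam α w)).re := by
  rw [one_sub_sq_div_stripDenom_diskParam hs hw, stripExp_mul_neg, mul_inv, ← Complex.ofReal_inv,
    ← Real.exp_neg, ← Complex.exp_neg, neg_neg]
  rw [mem_stripBase hs] at hw
  set t := 2 * Real.sin α * w.im
  set β := α - 2 * Real.sin α * w.re with hβ
  have h1 : 0 < Real.sin β :=
    Real.sin_pos_of_pos_of_lt_pi (by linarith [hw.2]) (by linarith [hw.1])
  have h2 : (((Real.exp t : ℝ) : ℂ) * Complex.exp (-((-β : ℝ) * Complex.I)) -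
      (Real.exp (-t) : ℝ) * Complex.exp ((-β : ℝ) * Complex.I)) /
      (2 * Complex.I * (Real.sin α : ℂ)) =
      (((Real.exp t : ℝ) : ℂ) * Complex.exp ((β : ℝ) * Complex.I) -
      (Real.exp (-t) : ℝ) * Complex.exp ((-β : ℝ) * Complex.I)) * -Complex.I *
      ((2 * Real.sin α)⁻¹ : ℝ) := by
    push_cast
    rw [div_eq_mul_inv, mul_inv, mul_inv, mul_inv, Complex.inv_I]
    simp only [neg_mul, neg_neg]
    ring
  rw [h2, Complex.re_mul_ofReal, ← div_eq_mul_inv]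
  have h3 : ((((Real.exp t : ℝ) : ℂ) * Complex.exp ((β : ℝ) * Complex.I) -
      (Real.exp (-t) : ℝ) * Complex.exp ((-β : ℝ) * Complex.I)) * -Complex.I).re =
      2 * Real.cosh t * Real.sin β := by
    rw [Real.cosh_eq, mul_neg, Complex.neg_re, Complex.mul_I_re, Complex.sub_im,
      Complex.im_ofReal_mul, Complex.im_ofReal_mul, Complex.exp_ofReal_mul_I_im,
      Complex.exp_ofReal_mul_I_im, Real.sin_neg]
    ring
  rw [h3, mul_assoc, mul_div_mul_left _ _ two_ne_zero]
  gcongr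
  nlinarith [Real.one_le_cosh t]

end Parametrization

/-! ### Transfer from the strip to the disk -/

/-- Harmonic functions composed with the strip parametrization. -/
theorem hasFDerivAt_harmonicOf_comp {h g Z : ℂ → ℂ} {w Z' : ℂ}
    (hh : DifferentiableAt ℂ h (Z w)) (hg : DifferentiableAt ℂ g (Z w)) (hZ : HasDerivAt Z Z' w) :
    HasFDerivAt (harmonicOf h g ∘ Z)
      (harmonicDifferential (deriv h (Z w) * Z') (deriv g (Z w) * Z')) w := by
  refine ((hasFDerivAt_harmonicOf hh hg).comp w (hZ.hasFDerivAt.restrictScalars ℝ)).congr_fderiv ?_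
  ext
  simp
  ring

/-- If `h' - g'` is the product of `1 / stripDenom` and a function whose real part dominates a
positive multiple of that of `(1 - z²) / stripDenom`, a sense-preserving `h + conj g` is injective
on the disk with image convex in the direction of the real axis. -/
theorem injOn_and_convexInRealDirection {α : ℝ} (hα : 0 < α) (hα' : α < Real.pi)
    {h g : ℂ → ℂ} (hpair : IsCanonicalPair h g)
    (hlt : ∀ z ∈ unitDisk, ‖deriv g z‖ < ‖deriv h z‖)
    (hre : ∀ z ∈ unitDisk, ((1 - z ^ 2) / stripDenom α z).re ≤
      2 * ((deriv h z - deriv g z) * stripDenom α z).re) :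
    InjOn (harmonicOf h g) unitDisk ∧
      ConvexInRealDirection (harmonicOf h g '' unitDisk) := by
  have hs := Real.sin_pos_of_pos_of_lt_pi hα hα'
  have hE : VerticallyExpanding ((α - Real.pi) / (2 * Real.sin α)) (α / (2 * Real.sin α))
      (harmonicOf h g ∘ diskParam α)
      (fun w => deriv h (diskParam α w) * stripDenom α (diskParam α w))
      (fun w => deriv g (diskParam α w) * stripDenom α (diskParam α w)) := by
    refine ⟨fun w hw => ?_, fun w hw => ?_, fun x hx => ?_⟩
    · have hz := diskParam_mem hs hw
      exact hasFDerivAt_harmonicOf_comp (hpair.analytic_left _ hz).differentiableAt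
        (hpair.analytic_right _ hz).differentiableAt (hasDerivAt_diskParam hs hw)
    · have hz := diskParam_mem hs hw
      rw [norm_mul, norm_mul]
      exact mul_lt_mul_of_pos_right (hlt _ hz) (norm_pos_iff.2 (stripDenom_ne_zero α hz))
    · have hx' := (mem_stripBase hs).1 hx
      have hsin : 0 < Real.sin (α - 2 * Real.sin α * x) :=
        Real.sin_pos_of_pos_of_lt_pi (by linarith [hx'.2]) (by linarith [hx'.1])
      -- The final halving absorbs the factor `2` in `hre`.
      refine ⟨Real.sin (α - 2 * Real.sin α * x) / Real.sin α / 2, by positivity, ?_⟩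
      rintro w rfl
      have h1 := sin_div_sin_le_re hs (w := w) hx
      have h2 := hre _ (diskParam_mem hs (w := w) hx)
      rw [← sub_mul]
      linarith
  have hmaps : MapsTo (diskParam α) {w | w.re ∈ stripBase α} unitDisk :=
    fun w hw => diskParam_mem hs hw
  have himg : diskParam α '' {w | w.re ∈ stripBase α} = unitDisk :=
    (surjOn_diskParam hα hα').image_eq_of_mapsTo hmaps
  constructor
  · rw [← himg]
    rintro _ ⟨w₁, h₁, rfl⟩ _ ⟨w₂, h₂, rfl⟩ heq
    rw [hE.injOn h₁ h₂ heq]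
  · rw [← himg, ← image_comp]
    exact hE.convexInRealDirection_image

/-! ### Derivatives of `h` and `g` from the shear equations -/

section Shear

variable {h g : ℂ → ℂ} {α : ℝ} {c : ℂ} {n : ℕ}

theorem one_add_ne_zero_of_norm_lt_one {u : ℂ} (hu : ‖u‖ < 1) : 1 + u ≠ 0 := by
  intro h
  rw [eq_neg_of_add_eq_zero_right h] at hu
  simp at hu

/-- The derivative of `h` when `h + g` is the strip mapping and `g' = c zⁿ h'`. -/
theorem deriv_mul_one_add_mul_stripDenom (hs : 0 < Real.sin α) (hpair : IsCanonicalPair h g)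
    (hstrip : ∀ z ∈ unitDisk, h z + g z = verticalStripMap α z)
    (hdil : ∀ z ∈ unitDisk, deriv g z = c * z ^ n * deriv h z) {z : ℂ} (hz : z ∈ unitDisk) :
    deriv h z * ((1 + c * z ^ n) * stripDenom α z) = 1 := by
  have h1 := (hpair.analytic_left z hz).differentiableAt.hasDerivAt.add
    (hpair.analytic_right z hz).differentiableAt.hasDerivAt
  have h2 : (h + g) =ᶠ[𝓝 z] verticalStripMap α := by
    filter_upwards [isOpen_unitDisk.mem_nhds hz] with t ht using hstrip t ht
  have h3 := (h1.congr_of_eventuallyEq h2.symm).unique (hasDerivAt_verticalStripMap hs hz)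
  rw [hdil z hz, eq_div_iff (stripDenom_ne_zero α hz)] at h3
  linear_combination h3

/-- Logarithmic differentiation of `h' (1 + ω) D = 1`, with `z D' = D - (1 - z²)`, `z ω' = n ω` and
`ω/(1 + ω) = (1 - p)/2`; the second identity differentiates `g' = ω h'`. -/
theorem mul_deriv_deriv (hs : 0 < Real.sin α) (hpair : IsCanonicalPair h g)
    (hstrip : ∀ z ∈ unitDisk, h z + g z = verticalStripMap α z)
    (hdil : ∀ z ∈ unitDisk, deriv g z = c * z ^ n * deriv h z) (hc : ‖c‖ = 1) (hn : n ≠ 0)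
    {z : ℂ} (hz : z ∈ unitDisk) :
    z * deriv (deriv h) z = deriv h z *
      ((1 - z ^ 2) / stripDenom α z - 1 -
        n * (1 - (1 - c * z ^ n) / (1 + c * z ^ n)) / 2) ∧
    z * deriv (deriv g) z = c * z ^ n * (n * deriv h z + z * deriv (deriv h) z) := by
  have hD := stripDenom_ne_zero α hz
  have hω : ‖c * z ^ n‖ < 1 := by
    rw [norm_mul, hc, one_mul, norm_pow]
    exact pow_lt_one₀ (norm_nonneg z) (mem_unitDisk.1 hz) hn
  have hω' := one_add_ne_zero_of_norm_lt_one hω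
  have hdh := (hpair.analytic_left z hz).deriv.differentiableAt.hasDerivAt
  have hdω : HasDerivAt (fun z => c * z ^ n) (c * (n * z ^ (n - 1))) z :=
    (hasDerivAt_pow n z).const_mul c
  have hpow : z * (c * (n * z ^ (n - 1))) = n * (c * z ^ n) := by
    rw [← mul_pow_sub_one hn z]
    ring
  have hdD : HasDerivAt (stripDenom α)
      (unimodular α * (1 + unimodular (-α) * z) + (1 + unimodular α * z) * unimodular (-α)) z := by
    have hlin : ∀ β, HasDerivAt (fun z => 1 + unimodular β * z) (unimodular β) z := fun β => by
      simpa using ((hasDerivAt_id z).const_mul (unimodular β)).const_add 1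
    exact (hlin α).mul (hlin (-α))
  have hzD : z * (unimodular α * (1 + unimodular (-α) * z) +
      (1 + unimodular α * z) * unimodular (-α)) = stripDenom α z - (1 - z ^ 2) := by
    rw [stripDenom]
    linear_combination z ^ 2 * unimodular_mul_neg α
  constructor
  · have hprod := hdh.mul ((hdω.const_add 1).mul hdD)
    have hev : (deriv h * ((fun z => 1 + c * z ^ n) * stripDenom α)) =ᶠ[𝓝 z] fun _ => 1 := by
      filter_upwards [isOpen_unitDisk.mem_nhds hz] with t ht
        using deriv_mul_one_add_mul_stripDenom hs hpair hstrip hdil ht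
    have h0 : deriv (deriv h) z * ((1 + c * z ^ n) * stripDenom α z) +
        deriv h z * (c * (n * z ^ (n - 1)) * stripDenom α z + (1 + c * z ^ n) *
          (unimodular α * (1 + unimodular (-α) * z) +
            (1 + unimodular α * z) * unimodular (-α))) = 0 :=
      hprod.unique ((hasDerivAt_const z (1 : ℂ)).congr_of_eventuallyEq hev)
    clear hprod hev hdD hdh
    generalize hωe : c * z ^ n = ω at *
    generalize stripDenom α z = D at *
    generalize deriv (deriv h) z = k at *
    have h1 : z * k * ((1 + ω) * D) +
        deriv h z * (n * ω * D + (1 + ω) * (D - (1 - z ^ 2))) = 0 := by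
      linear_combination z * h0 - deriv h z * D * hpow - deriv h z * (1 + ω) * hzD
    refine mul_right_cancel₀ (mul_ne_zero hω' hD) ?_
    field_simp
    linear_combination 2 * h1
  · have hev : deriv g =ᶠ[𝓝 z] fun z => c * z ^ n * deriv h z := by
      filter_upwards [isOpen_unitDisk.mem_nhds hz] with t ht using hdil t ht
    rw [((hdω.mul hdh).congr_of_eventuallyEq hev).deriv]
    linear_combination deriv h z * hpow

end Shear

/-! ### The convolution `H + conj G` and its derivatives -/

theorem norm_sub_half_lt_norm_add_half {u : ℂ} (hu : 0 < u.re) : ‖u - 1 / 2‖ < ‖u + 1 / 2‖ := by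
  refine lt_of_pow_lt_pow_left₀ 2 (norm_nonneg _) ?_
  rw [← Complex.normSq_eq_norm_sq, ← Complex.normSq_eq_norm_sq, Complex.normSq_apply,
    Complex.normSq_apply]
  norm_num
  linarith

section Convolution

variable {h g : ℂ → ℂ}

theorem IsCanonicalPair.convolution (hpair : IsCanonicalPair h g) :
    IsCanonicalPair (fun z => (h z + z * deriv h z) / 2) (fun z => (g z - z * deriv g z) / 2) where
  analytic_left z hz :=
    ((hpair.analytic_left z hz).add (analyticAt_id.mul (hpair.analytic_left z hz).deriv)).div_const
  analytic_right z hz :=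
    ((hpair.analytic_right z hz).sub
      (analyticAt_id.mul (hpair.analytic_right z hz).deriv)).div_const
  left_zero := by simp [hpair.left_zero]
  right_zero := by simp [hpair.right_zero]

theorem harmonicConv_eqOn (hpair : IsCanonicalPair h g) :
    EqOn (harmonicConv h₀ g₀ h g)
      (harmonicOf (fun z => (h z + z * deriv h z) / 2) (fun z => (g z - z * deriv g z) / 2))
      unitDisk := fun z hz => by
  rw [harmonicConv, harmonicOf, harmonicOf, hadamard_h₀ hpair.analytic_left hpair.left_zero hz,
    hadamard_g₀ hpair.analytic_right hpair.right_zero hz]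

theorem deriv_convolution_left (hpair : IsCanonicalPair h g) {z : ℂ} (hz : z ∈ unitDisk) :
    deriv (fun z => (h z + z * deriv h z) / 2) z = (2 * deriv h z + z * deriv (deriv h) z) / 2 := by
  have h1 := (hpair.analytic_left z hz).differentiableAt.hasDerivAt
  have h2 := (hpair.analytic_left z hz).deriv.differentiableAt.hasDerivAt
  refine (((h1.fun_add ((hasDerivAt_id' z).fun_mul h2)).div_const 2).congr_deriv ?_).deriv
  ring

theorem deriv_convolution_right (hpair : IsCanonicalPair h g) {z : ℂ} (hz : z ∈ unitDisk) :
    deriv (fun z => (g z - z * deriv g z) / 2) z = -(z * deriv (deriv g) z) / 2 := by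
  have h1 := (hpair.analytic_right z hz).differentiableAt.hasDerivAt
  have h2 := (hpair.analytic_right z hz).deriv.differentiableAt.hasDerivAt
  refine (((h1.fun_sub ((hasDerivAt_id' z).fun_mul h2)).div_const 2).congr_deriv ?_).deriv
  ring

end Convolution

end HarmonicConvolution

end

/-! ### Dilatation estimate and conclusion -/

open HarmonicConvolution in
theorem theorem5 (h g : ℂ → ℂ) (α θ : ℝ) (n : ℕ)
    (hα : Real.pi / 2 ≤ α) (hα' : α < Real.pi)
    (hpair : HarmonicConvolution.IsCanonicalPair h g)
    (hK : HarmonicConvolution.ClassKHO (HarmonicConvolution.harmonicOf h g))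
    (hstrip : ∀ z ∈ HarmonicConvolution.unitDisk,
      h z + g z = HarmonicConvolution.verticalStripMap α z)
    (hdil : ∀ z ∈ HarmonicConvolution.unitDisk,
      HarmonicConvolution.dilatation h g z = Complex.exp ((θ : ℂ) * Complex.I) * z ^ n)
    (hn : n = 1 ∨ n = 2) :
    HarmonicConvolution.ClassSHO
        (HarmonicConvolution.harmonicConv
          HarmonicConvolution.h₀ HarmonicConvolution.g₀ h g) ∧
      HarmonicConvolution.ConvexInRealDirection
        (HarmonicConvolution.harmonicConv
          HarmonicConvolution.h₀ HarmonicConvolution.g₀ h g '' HarmonicConvolution.unitDisk) := by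
  have hα0 : 0 < α := by linarith [Real.pi_pos]
  have hs := Real.sin_pos_of_pos_of_lt_pi hα0 hα'
  have h0mem : (0 : ℂ) ∈ unitDisk := by simp [mem_unitDisk]
  have hn0 : n ≠ 0 := by omega
  set c := Complex.exp ((θ : ℂ) * Complex.I)
  have hc : ‖c‖ = 1 := Complex.norm_exp_ofReal_mul_I θ
  have hlt : ∀ z ∈ unitDisk, ‖deriv g z‖ < ‖deriv h z‖ := fun z hz => by
    have := hK.sensePreserving z hz
    rwa [wirtinger_harmonicOf (hpair.analytic_left z hz).differentiableAt
      (hpair.analytic_right z hz).differentiableAt,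
      wirtingerBar_harmonicOf (hpair.analytic_left z hz).differentiableAt
      (hpair.analytic_right z hz).differentiableAt, RCLike.norm_conj] at this
  have hh0 : deriv h 0 = 1 := by
    rw [← wirtinger_harmonicOf (hpair.analytic_left 0 h0mem).differentiableAt
      (hpair.analytic_right 0 h0mem).differentiableAt, hK.wirtinger_zero]
  -- Division by zero returns `0`, so `h' ≠ 0` is needed to recover `g' = ω h'` from the quotient.
  have hne : ∀ z ∈ unitDisk, deriv h z ≠ 0 := fun z hz =>
    norm_pos_iff.1 ((norm_nonneg _).trans_lt (hlt z hz))
  have hdil' : ∀ z ∈ unitDisk, deriv g z = c * z ^ n * deriv h z := fun z hz => by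
    rw [← hdil z hz, dilatation, div_mul_cancel₀ _ (hne z hz)]
  have hω : ∀ z ∈ unitDisk, ‖c * z ^ n‖ < 1 := fun z hz => by
    rw [norm_mul, hc, one_mul, norm_pow]
    exact pow_lt_one₀ (norm_nonneg z) (mem_unitDisk.1 hz) hn0
  have hconv := hpair.convolution
  set H : ℂ → ℂ := fun z => (h z + z * deriv h z) / 2 with hH
  set G : ℂ → ℂ := fun z => (g z - z * deriv g z) / 2 with hG
  have hH' : ∀ z ∈ unitDisk, deriv H z = deriv h z / 2 * ((1 - z ^ 2) / stripDenom α z + 1 -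
      n * (1 - (1 - c * z ^ n) / (1 + c * z ^ n)) / 2) := fun z hz => by
    rw [hH, deriv_convolution_left hpair hz,
      (mul_deriv_deriv hs hpair hstrip hdil' hc hn0 hz).1]
    ring
  have hG' : ∀ z ∈ unitDisk, deriv G z = -(deriv h z / 2 * (c * z ^ n *
      ((1 - z ^ 2) / stripDenom α z - 1 +
        n * (1 + (1 - c * z ^ n) / (1 + c * z ^ n)) / 2))) := fun z hz => by
    rw [hG, deriv_convolution_right hpair hz,
      (mul_deriv_deriv hs hpair hstrip hdil' hc hn0 hz).2,
      (mul_deriv_deriv hs hpair hstrip hdil' hc hn0 hz).1]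
    ring
  have hlt' : ∀ z ∈ unitDisk, ‖deriv G z‖ < ‖deriv H z‖ := fun z hz => by
    have hR := re_one_sub_sq_div_stripDenom_pos α hz
    have hp := re_one_sub_div_one_add_pos (hω z hz)
    rw [hH' z hz, hG' z hz, norm_neg, norm_mul (deriv h z / 2), norm_mul (deriv h z / 2),
      norm_mul (c * z ^ n)]
    refine mul_lt_mul_of_pos_left ?_ (norm_pos_iff.2 (div_ne_zero (hne z hz) two_ne_zero))
    generalize (1 - z ^ 2) / stripDenom α z = R at *
    generalize (1 - c * z ^ n) / (1 + c * z ^ n) = p at *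
    have hωz := hω z hz
    rcases hn with rfl | rfl
    -- For `n = 1`, `R + p/2` lies in the right half-plane, hence closer to `1/2` than to `-1/2`.
    · have h1 : 0 < (R + p / 2).re := by
        rw [Complex.add_re, Complex.div_ofNat_re]
        positivity
      have h2 := norm_sub_half_lt_norm_add_half h1
      have e1 : R - 1 + (1 : ℕ) * (1 + p) / 2 = R + p / 2 - 1 / 2 := by push_cast; ring
      have e2 : R + 1 - (1 : ℕ) * (1 - p) / 2 = R + p / 2 + 1 / 2 := by push_cast; ring
      rw [e1, e2]
      exact (mul_le_of_le_one_left (norm_nonneg _) hωz.le).trans_lt h2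
    -- For `n = 2` the brackets coincide, so the dilatation of the convolution is `-ω`; `R + p ≠ 0`
    -- makes the inequality strict.
    · have e1 : R - 1 + (2 : ℕ) * (1 + p) / 2 = R + p := by push_cast; ring
      have e2 : R + 1 - (2 : ℕ) * (1 - p) / 2 = R + p := by push_cast; ring
      rw [e1, e2]
      refine mul_lt_of_lt_one_left (norm_pos_iff.2 fun h0 => ?_) hωz
      have h1 : (R + p).re = 0 := by rw [h0, Complex.zero_re]
      rw [Complex.add_re] at h1
      linarith
  have hre : ∀ z ∈ unitDisk, ((1 - z ^ 2) / stripDenom α z).re ≤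
      2 * ((deriv H z - deriv G z) * stripDenom α z).re := fun z hz => by
    have hp := re_one_sub_div_one_add_pos (hω z hz)
    have hω' := one_add_ne_zero_of_norm_lt_one (hω z hz)
    have hprod := deriv_mul_one_add_mul_stripDenom hs hpair hstrip hdil' hz
    -- The terms in `n` cancel because `p (1 + ω) = 1 - ω`; dropping `Re p > 0` then leaves the
    -- required bound.
    have key : (deriv H z - deriv G z) * stripDenom α z =
        ((1 - z ^ 2) / stripDenom α z + (1 - c * z ^ n) / (1 + c * z ^ n)) / 2 := by
      rw [hH' z hz, hG' z hz]
      generalize (1 - z ^ 2) / stripDenom α z = R at *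
      have hpe : (1 - c * z ^ n) / (1 + c * z ^ n) * (1 + c * z ^ n) = 1 - c * z ^ n :=
        div_mul_cancel₀ _ hω'
      generalize (1 - c * z ^ n) / (1 + c * z ^ n) = p at *
      linear_combination ((R + p) / 2) * hprod +
        (deriv h z * stripDenom α z / 2 * ((n : ℂ) / 2 * 1 - 1)) * hpe
    rw [key, Complex.div_ofNat_re, Complex.add_re]
    linarith
  obtain ⟨hinj, hcv⟩ := injOn_and_convexInRealDirection hα0 hα' hconv hlt' hre
  have heq := harmonicConv_eqOn hpair
  refine ⟨classSHO_of_eqOn heq hconv hlt' (hinj.congr heq.symm) ?_ ?_, ?_⟩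
  · rw [deriv_convolution_left hpair h0mem, hh0]
    norm_num
  · rw [deriv_convolution_right hpair h0mem]
    simp
  · rwa [heq.image_eq]
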